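/- A (non-degenerate) cycle set is a set $X$ with a binary operation $\cdot$ such that every left multiplication $\sigma_x : y \mapsto x\cdot y$ and the squaring map $T : x\mapsto x\cdot x$ are bijective and $(x\cdot y)\cdot(x\cdot z)=(y\cdot x)\cdot(y\cdot z)$ for all $x,y,z\in X$. Let $\mathcal{G}(X)\le \mathrm{Sym}(X)$ be the group generated by all $\sigma_x$; $X$ is indecomposable if $\mathcal{G}(X)$ acts transitively on $X$. $X$ is simple if for every surjective homomorphism of cycle sets $X\to Y$ either $X\cong Y$ or $|Y|=1$, and $X$ is irretractable if $\sigma_x=\sigma_y$ implies $x=y$, i.e. if the canonical map from $X$ to its retraction $\mathrm{Ret}(X)$ is bijective. For finite $X$, $\mathcal{G}(X)$ is a left brace whose operation $\circ$ is composition and whose addition is determined by $\sigma_x^{-1}+\sigma_y^{-1}=\sigma_x^{-1}\circ\sigma_{\sigma_x(y)}^{-1}$ for all $x,y \in X$; the socle $\mathrm{Soc}(B)$ of a left brace $B$ is the kernel of the homomorphism $\lambda:(B,\circ)\to\mathrm{Aut}(B,+)$, $\lambda_a(b)=-a+a\circ b$. Proposition. Let $X$ be a finite indecomposable cycle set whose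 squaring map $T$ is a $p$-cycle (a single cycle of length $p$, all other points being fixed) for a prime number $p$. Then $X$ is simple. In particular, if $|X|$ is not a prime number, then $X$ is irretractable and $\mathrm{Soc}(\mathcal{G}(X))=\{0\}$. -/

import Mathlib

/-- A left brace: an additive abelian group and a multiplicative group (the operation `∘`) on the
same set with `x ∘ (y + z) + x = x ∘ y + x ∘ z`. -/
class LeftBrace (B : Type*) extends AddCommGroup B, Group B where
  brace_eq : ∀ x y z : B, x * (y + z) + x = x * y + x * z

namespace LeftBrace

variable {B : Type*} [LeftBrace B]

theorem mul_zero_eq (x : B) : x * 0 = x := by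
  have h := brace_eq x 0 0
  rw [add_zero] at h
  exact (add_left_cancel h).symm

theorem mul_add_eq (x y z : B) : x * (y + z) = x * y - x + x * z := by
  have h := brace_eq x y z
  rw [eq_sub_of_add_eq h]
  abel

theorem mul_neg_eq (x y : B) : x * (-y) = x - x * y + x := by
  have h := brace_eq x y (-y)
  rw [add_neg_cancel, mul_zero_eq] at h
  rw [eq_sub_of_add_eq' h.symm]
  abel

/-- The automorphism `λ_x` of `(B, +)`, where `λ_x(y) = -x + x ∘ y`. -/
def lambdaAut (x : B) : AddAut B where
  toFun y := -x + x * y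
  invFun y := x⁻¹ * (x + y)
  left_inv y := by simp
  right_inv y := by simp
  map_add' y z := by
    rw [mul_add_eq]
    abel

/-- The group homomorphism `λ : (B, ∘) → Aut (B, +)`. Here `Multiplicative` only says that the
composition in `Aut (B, +)` is written multiplicatively. -/
def lambda (B : Type*) [LeftBrace B] : B →* Multiplicative (AddAut B) where
  toFun x := Multiplicative.ofAdd (lambdaAut x)
  map_one' := by
    apply congrArg Multiplicative.ofAdd (a₂ := (0 : AddAut B))
    ext y
    have h : (1 : B) = 0 := by simpa using (mul_zero_eq (1 : B)).symm
    change -(1 : B) + 1 * y = y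
    rw [one_mul, h, neg_zero, zero_add]
  map_mul' x y := by
    apply congrArg Multiplicative.ofAdd (a₂ := lambdaAut x + lambdaAut y)
    ext z
    change -(x * y) + x * y * z = -x + x * (-y + y * z)
    rw [mul_add_eq, mul_neg_eq, mul_assoc]
    abel

/-- The socle of a left brace: the kernel of `λ`. -/
def socle (B : Type*) [LeftBrace B] : Subgroup B := (lambda B).ker

end LeftBrace

/-- A (non-degenerate) cycle set: a binary operation with bijective left multiplications and
bijective squaring map which satisfies the cycloid equation. -/
class CycleSet (X : Type*) where
  /-- the operation `x · y` -/
  dot : X → X → X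
  bijective_dot : ∀ x : X, Function.Bijective (dot x)
  cycloid : ∀ x y z : X, dot (dot x y) (dot x z) = dot (dot y x) (dot y z)
  bijective_sq : Function.Bijective fun x : X => dot x x

namespace CycleSet

/-- The left multiplication `σ_x : y ↦ x · y`. -/
noncomputable def sigma {X : Type*} [CycleSet X] (x : X) : Equiv.Perm X :=
  Equiv.ofBijective (dot x) (bijective_dot x)

/-- The squaring map `T : x ↦ x · x`. -/
noncomputable def squaringMap (X : Type*) [CycleSet X] : Equiv.Perm X :=
  Equiv.ofBijective (fun x : X => dot x x) bijective_sq

/-- The associated permutation group `𝒢(X)`, generated by all `σ_x`. -/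
def permGroup (X : Type*) [CycleSet X] : Subgroup (Equiv.Perm X) :=
  Subgroup.closure (Set.range (sigma (X := X)))

/-- `X` is indecomposable if `𝒢(X)` acts transitively on `X`. -/
def IsIndecomposable (X : Type*) [CycleSet X] : Prop :=
  MulAction.IsPretransitive (permGroup X) X

/-- Homomorphisms of cycle sets. -/
def IsHom {X Y : Type*} [CycleSet X] [CycleSet Y] (f : X → Y) : Prop :=
  ∀ x y : X, f (dot x y) = dot (f x) (f y)

/-- `X` is simple if every epimorphic image `Y` of `X` is isomorphic to `X` or has one element.
(Every epimorphic image is isomorphic to a quotient of `X`, so that one universe is enough.) -/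
def IsSimple.{u} (X : Type u) [CycleSet X] : Prop :=
  ∀ (Y : Type u) [CycleSet Y] (f : X → Y), IsHom f → Function.Surjective f →
    (∃ g : X → Y, IsHom g ∧ Function.Bijective g) ∨ Nat.card Y = 1

/-- The retract relation: `x ∼ y` if and only if `σ_x = σ_y`. -/
noncomputable def retractSetoid (X : Type*) [CycleSet X] : Setoid X := Setoid.ker (sigma (X := X))

/-- The underlying set of the retraction of `X`. -/
def Ret (X : Type*) [CycleSet X] : Type _ := Quotient (retractSetoid X)

/-- `X` is irretractable if `Ret X = X`, that is, if the canonical map `X → Ret X` is bijective. -/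
def IsIrretractable (X : Type*) [CycleSet X] : Prop :=
  Function.Bijective (Quotient.mk (retractSetoid X) : X → Ret X)

/-! The left brace structure on `𝒢(X)`. Every finite sum of elements `σ_x⁻¹` (with repetitions) is
evaluated as a permutation, by means of `g + σ_x⁻¹ = g ∘ (σ_{g⁻¹(x)})⁻¹`; for finite `X` every
element of `𝒢(X)` arises in this way, and the addition of `𝒢(X)` is induced by the addition of
multisets. -/

section Brace

variable {X : Type*} [CycleSet X]

theorem sigma_mul_sigma (x y : X) :
    sigma (dot x y) * sigma x = sigma (dot y x) * sigma y := by
  ext z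
  exact cycloid x y z

/-- The permutation `g + σ_x⁻¹`. -/
noncomputable def addGen (x : X) (g : Equiv.Perm X) : Equiv.Perm X :=
  g * (sigma (g⁻¹ x))⁻¹

instance : LeftCommutative (addGen (X := X)) where
  left_comm x y g := by
    have h : ∀ u v : X, (sigma u)⁻¹ * (sigma (dot u v))⁻¹ = (sigma v)⁻¹ * (sigma (dot v u))⁻¹ := by
      intro u v
      rw [← mul_inv_rev, ← mul_inv_rev, sigma_mul_sigma]
    have e : ∀ u v : X, addGen u (addGen v g)
        = g * ((sigma (g⁻¹ v))⁻¹ * (sigma (dot (g⁻¹ v) (g⁻¹ u)))⁻¹) := by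
      intro u v
      simp only [addGen, mul_inv_rev, inv_inv, mul_assoc]
      rfl
    rw [e, e, h]

/-- The permutation `σ_{x₁}⁻¹ + ⋯ + σ_{xₙ}⁻¹` for a multiset `{x₁, …, xₙ}`. -/
noncomputable def sumPerm (s : Multiset X) : Equiv.Perm X := s.foldr addGen 1

theorem sumPerm_cons (x : X) (s : Multiset X) :
    sumPerm (x ::ₘ s) = sumPerm s * (sigma ((sumPerm s)⁻¹ x))⁻¹ :=
  Multiset.foldr_cons _ _ _ _

theorem sumPerm_singleton (x : X) : sumPerm {x} = (sigma x)⁻¹ := by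
  rw [← Multiset.cons_zero, sumPerm_cons]
  simp [sumPerm]

theorem sumPerm_add (s t : Multiset X) :
    sumPerm (s + t) = sumPerm s * sumPerm (t.map ⇑(sumPerm s)⁻¹) := by
  induction t using Multiset.induction_on with
  | empty => simp [sumPerm]
  | cons y t ih =>
    rw [Multiset.add_cons, sumPerm_cons, ih, Multiset.map_cons, sumPerm_cons, mul_inv_rev,
      mul_assoc]
    rfl

theorem sumPerm_mem (s : Multiset X) : sumPerm s ∈ permGroup X := by
  induction s using Multiset.induction_on with
  | empty => exact one_mem _
  | cons y t ih =>
    rw [sumPerm_cons]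
    exact mul_mem ih (inv_mem (Subgroup.subset_closure ⟨_, rfl⟩))

theorem sumPerm_mul (s t : Multiset X) :
    sumPerm s * sumPerm t = sumPerm (s + t.map (sumPerm s)) := by
  rw [sumPerm_add, Multiset.map_map]
  simp

theorem exists_sumPerm [Finite X] (g : permGroup X) : ∃ s : Multiset X, sumPerm s = g := by
  obtain ⟨g, hg⟩ := g
  have hpow : ∀ (s : Multiset X) (n : ℕ), ∃ t : Multiset X, sumPerm t = sumPerm s ^ n := by
    intro s n
    induction n with
    | zero => exact ⟨0, by simp [sumPerm]⟩
    | succ n ih =>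
      obtain ⟨t, ht⟩ := ih
      exact ⟨_, by rw [pow_succ, ← ht, sumPerm_mul]⟩
  have hinv : ∀ s : Multiset X, ∃ t : Multiset X, sumPerm t = (sumPerm s)⁻¹ := by
    intro s
    have h : (sumPerm s)⁻¹ ∈ Submonoid.powers (sumPerm s) :=
      mem_powers_iff_mem_zpowers.2 (inv_mem (Subgroup.mem_zpowers _))
    obtain ⟨n, hn⟩ := h
    obtain ⟨t, ht⟩ := hpow s n
    exact ⟨t, ht.trans hn⟩
  change ∃ s : Multiset X, sumPerm s = g
  induction hg using Subgroup.closure_induction with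
  | mem x hx =>
    obtain ⟨y, rfl⟩ := hx
    obtain ⟨t, ht⟩ := hinv {y}
    exact ⟨t, by rw [ht, sumPerm_singleton, inv_inv]⟩
  | one => exact ⟨0, by simp [sumPerm]⟩
  | mul x y _ _ hx hy =>
    obtain ⟨s, rfl⟩ := hx
    obtain ⟨t, rfl⟩ := hy
    exact ⟨_, (sumPerm_mul s t).symm⟩
  | inv x _ hx =>
    obtain ⟨s, rfl⟩ := hx
    exact hinv s

/-- `sumPerm` as a map into `𝒢(X)`. -/
noncomputable def sumG (s : Multiset X) : permGroup X := ⟨sumPerm s, sumPerm_mem s⟩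

theorem sumG_surjective [Finite X] : Function.Surjective (sumG (X := X)) := fun g =>
  (exists_sumPerm g).imp fun _ h => Subtype.ext h

theorem sumG_mul (s t : Multiset X) : sumG s * sumG t = sumG (s + t.map (sumPerm s)) :=
  Subtype.ext (sumPerm_mul s t)

theorem sumG_add_congr {s s' t t' : Multiset X} (hs : sumG s = sumG s') (ht : sumG t = sumG t') :
    sumG (s + t) = sumG (s' + t') := by
  have h1 : ∀ {a a' : Multiset X} (b : Multiset X), sumG a = sumG a' →
      sumG (a + b) = sumG (a' + b) := by
    intro a a' b h
    have h' : sumPerm a = sumPerm a' := congrArg Subtype.val h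
    apply Subtype.ext
    change sumPerm (a + b) = sumPerm (a' + b)
    rw [sumPerm_add, sumPerm_add, h']
  rw [h1 t hs, add_comm s' t, h1 s' ht, add_comm]

/-- A multiset whose evaluation is `g`. -/
noncomputable def rep [Finite X] (g : permGroup X) : Multiset X := (sumG_surjective g).choose

theorem sumG_rep [Finite X] (g : permGroup X) : sumG (rep g) = g := (sumG_surjective g).choose_spec

noncomputable instance [Finite X] : Add (permGroup X) := ⟨fun g h => sumG (rep g + rep h)⟩

instance : Zero (permGroup X) := ⟨1⟩

noncomputable instance [Finite X] : Neg (permGroup X) :=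
  ⟨fun g => sumG ((rep g⁻¹).map (g : Equiv.Perm X))⟩

theorem sumG_add [Finite X] (s t : Multiset X) : sumG s + sumG t = sumG (s + t) :=
  sumG_add_congr (sumG_rep _) (sumG_rep _)

theorem sumG_zero : sumG (0 : Multiset X) = 0 := rfl

/-- The left brace `𝒢(X)` of a finite cycle set: `∘` is the composition of permutations, and `+` is
the addition with `σ_x⁻¹ + σ_y⁻¹ = σ_x⁻¹ ∘ (σ_{σ_x(y)})⁻¹`. -/
noncomputable instance permGroupLeftBrace [Finite X] : LeftBrace (permGroup X) where
  toGroup := inferInstance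
  add_assoc a b c := by
    obtain ⟨s, rfl⟩ := sumG_surjective a
    obtain ⟨t, rfl⟩ := sumG_surjective b
    obtain ⟨u, rfl⟩ := sumG_surjective c
    simp only [sumG_add, add_assoc]
  zero_add a := by
    obtain ⟨s, rfl⟩ := sumG_surjective a
    rw [← sumG_zero, sumG_add, zero_add]
  add_zero a := by
    obtain ⟨s, rfl⟩ := sumG_surjective a
    rw [← sumG_zero, sumG_add, add_zero]
  add_comm a b := by
    obtain ⟨s, rfl⟩ := sumG_surjective a
    obtain ⟨t, rfl⟩ := sumG_surjective b
    rw [sumG_add, sumG_add, add_comm]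
  nsmul := nsmulRec
  zsmul := zsmulRec
  neg_add_cancel a := by
    change sumG ((rep a⁻¹).map (a : Equiv.Perm X)) + a = 0
    have h : sumPerm (rep a) = a := congrArg Subtype.val (sumG_rep a)
    rw [← h]
    nth_rewrite 3 [← sumG_rep a]
    rw [sumG_add, add_comm, ← sumG_mul, sumG_rep, sumG_rep, mul_inv_cancel]
    rfl
  brace_eq a b c := by
    obtain ⟨s, rfl⟩ := sumG_surjective a
    obtain ⟨t, rfl⟩ := sumG_surjective b
    obtain ⟨u, rfl⟩ := sumG_surjective c
    simp only [sumG_add, sumG_mul, Multiset.map_add]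
    congr 1
    abel

/-- `σ_x` as an element of `𝒢(X)`. -/
noncomputable def sigmaG (x : X) : permGroup X := ⟨sigma x, Subgroup.subset_closure ⟨x, rfl⟩⟩

/-- The rule that determines the addition of `𝒢(X)`. -/
theorem inv_sigmaG_add [Finite X] (x y : X) :
    (sigmaG x)⁻¹ + (sigmaG y)⁻¹ = (sigmaG x)⁻¹ * (sigmaG (sigma x y))⁻¹ := by
  have h : ∀ z : X, (sigmaG z)⁻¹ = sumG {z} := fun z => Subtype.ext (sumPerm_singleton z).symm
  rw [h x, h y, sumG_add]
  apply Subtype.ext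
  change sumPerm ({x} + {y}) = sumPerm {x} * (sigma (sigma x y))⁻¹
  rw [sumPerm_add, Multiset.map_singleton, sumPerm_singleton, sumPerm_singleton, inv_inv]

end Brace

end CycleSet

/-! An epimorphism `f : X → Y` intertwines the squaring maps. If `Y` is square-free, it is a point
by Rump's theorem (`IsIndecomposable.subsingleton`). Otherwise the squaring map `T_Y` moves some `f
x`. The fibre of `f x` then lies on the `p`-cycle, and a second point `T ^ i x` in it, `p ∤ i`,
would make `T_Y ^ i` and `T_Y ^ p`, hence `T_Y`, fix `f x`. So this fibre is a single point, and by
transitivity all fibres are (`IsHom.injective_of_fibre`). For the epimorphism onto `Ret X` this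
leaves irretractability or equality of all `σ_x`; in the latter case every point lies on the
`p`-cycle. Since `λ_g` maps `σ_x⁻¹` to the inverse of `σ` at `g x`, irretractability kills the
socle.

Rump's theorem needs the solvability of `(B, ∘)` for a finite left brace `B`. The primary parts of
`(B, +)` and their sums are Hall subgroups of `(B, ∘)`, so Wielandt's theorem reduces solvability to
orders with at most two prime divisors, which is Burnside's theorem, proved here with characters.
Solvability places a point stabilizer inside a proper subgroup of prime power index, and counting
inside the corresponding Sylow subgroup gives a contradiction
(`LeftBrace.subsingleton_of_smul_eq_self`). -/

/-! ### Averages of roots of unity. -/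

/-- A sum of complex numbers of norm one which has the largest possible norm has equal terms. -/
theorem Complex.eq_of_sum_eq_card_mul (s : Multiset ℂ) (hs : ∀ r ∈ s, ‖r‖ = 1) (a : ℂ)
    (ha : ‖a‖ = 1) (h : s.sum = s.card * a) : ∀ r ∈ s, r = a := by
  have haa : a * starRingEnd ℂ a = 1 := by rw [Complex.mul_conj']; simp [ha]
  -- The numbers `1 - Re (r * conj a)` are nonnegative and add up to zero, so each of them vanishes.
  have hle : ∀ r ∈ s, (r * starRingEnd ℂ a).re ≤ 1 := fun r hr =>
    (Complex.re_le_norm _).trans (by simp [hs r hr, ha])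
  have hsum : (s.map fun r => 1 - (r * starRingEnd ℂ a).re).sum = 0 := by
    have h1 : (s.map fun r => (r * starRingEnd ℂ a).re).sum = s.card := by
      have h2 : (s.map fun r => r * starRingEnd ℂ a).sum = s.card := by
        rw [Multiset.sum_map_mul_right, Multiset.map_id', h, mul_assoc, haa, mul_one]
      have h3 := congrArg Complex.reAddGroupHom h2
      rw [map_multiset_sum, Multiset.map_map] at h3
      simpa [Function.comp_def] using h3
    rw [Multiset.sum_map_sub, h1]
    simp
  intro r hr
  have h0 : 1 - (r * starRingEnd ℂ a).re = 0 := by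
    have := Multiset.all_zero_of_le_zero_le_of_sum_eq_zero
      (s := s.map fun r => 1 - (r * starRingEnd ℂ a).re)
      (by
        intro x hx
        obtain ⟨r, hr, rfl⟩ := Multiset.mem_map.1 hx
        linarith [hle r hr]) hsum
    exact this _ (Multiset.mem_map_of_mem _ hr)
  have hn : ‖r * starRingEnd ℂ a‖ = 1 := by simp [hs r hr, ha]
  have h1 : r * starRingEnd ℂ a = 1 := by
    have hre : (r * starRingEnd ℂ a).re = 1 := by linarith
    have h2 := Complex.sq_norm_sub_sq_re (r * starRingEnd ℂ a)
    rw [hn, hre] at h2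
    have him : (r * starRingEnd ℂ a).im = 0 := by nlinarith
    exact Complex.ext (by simpa using hre) (by simpa using him)
  calc r = r * (a * starRingEnd ℂ a) := by rw [haa, mul_one]
    _ = (r * starRingEnd ℂ a) * a := by ring
    _ = a := by rw [h1, one_mul]

/-- If the average of complex roots of unity is a nonzero algebraic integer, then the roots of
unity are all equal. -/
theorem Complex.eq_of_isIntegral_average {n : ℕ} (hn : 0 < n) (s : Multiset ℂ)
    (hs : ∀ r ∈ s, r ^ n = 1) (a : ℂ) (ha : IsIntegral ℤ a) (ha0 : a ≠ 0)
    (h : s.sum = s.card * a) : ∀ r ∈ s, r = a := by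
  rcases s.empty_or_exists_mem with rfl | ⟨r₀, hr₀⟩
  · simp
  have hs0 : s.card ≠ 0 := (Multiset.card_pos_iff_exists_mem.2 ⟨r₀, hr₀⟩).ne'
  let K := IntermediateField.adjoin ℚ {r : ℂ | r ^ n = 1}
  have hfin : {r : ℂ | r ^ n = 1}.Finite := by
    refine (Polynomial.nthRoots n (1 : ℂ)).toFinset.finite_toSet.subset fun r hr => ?_
    simpa [Polynomial.mem_nthRoots hn] using hr
  have : FiniteDimensional ℚ K := by
    have := hfin.to_subtype
    refine IntermediateField.finiteDimensional_adjoin fun r hr => ?_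
    refine IsIntegral.of_pow hn ?_
    rw [show r ^ n = 1 from hr]
    exact isIntegral_one
  have : NumberField K := ⟨⟩
  have hmem : ∀ r ∈ s, r ∈ K := fun r hr => IntermediateField.subset_adjoin ℚ _ (hs r hr)
  obtain ⟨t, rfl⟩ : ∃ t : Multiset K, t.map (algebraMap K ℂ) = s := by
    refine ⟨s.pmap (fun r hr => (⟨r, hr⟩ : K)) hmem, ?_⟩
    rw [Multiset.map_pmap]
    exact (Multiset.pmap_eq_map (fun r : ℂ => r ∈ K) (fun r => r) s hmem).trans (Multiset.map_id' _)
  rw [Multiset.card_map] at h hs0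
  have hc0 : (t.card : K) ≠ 0 := by exact_mod_cast hs0
  have hc0' : (t.card : ℂ) ≠ 0 := by exact_mod_cast hs0
  obtain ⟨b, rfl⟩ : ∃ b : K, algebraMap K ℂ b = a := by
    refine ⟨t.sum / t.card, ?_⟩
    rw [map_div₀, map_multiset_sum, h, map_natCast]
    field_simp
  have hb : t.sum = t.card * b := by
    apply (algebraMap K ℂ).injective
    rw [map_multiset_sum, h, map_mul, map_natCast]
  have ht : ∀ r ∈ t, r ^ n = 1 := by
    intro r hr
    apply (algebraMap K ℂ).injective
    rw [map_pow, map_one]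
    exact hs _ (Multiset.mem_map_of_mem _ hr)
  -- Every conjugate of `b` is again an average of roots of unity. By Kronecker's theorem `b` is
  -- then itself a root of unity, so the average has the largest possible norm.
  have hφ : ∀ φ : K →+* ℂ, ‖φ b‖ ≤ 1 := by
    intro φ
    have h1 : ‖(t.card : ℂ) * φ b‖ ≤ t.card := by
      rw [← map_natCast φ, ← map_mul, ← hb, map_multiset_sum]
      refine (norm_multiset_sum_le _).trans ?_
      rw [Multiset.map_map]
      have : ∀ r ∈ t, ((fun x => ‖x‖) ∘ φ) r = 1 := by
        intro r hr
        refine Complex.norm_eq_one_of_pow_eq_one (n := n) ?_ hn.ne'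
        rw [← map_pow, ht r hr, map_one]
      rw [Multiset.map_congr rfl this]
      simp
    rw [norm_mul, Complex.norm_natCast] at h1
    have : (0 : ℝ) < t.card := by exact_mod_cast Nat.pos_of_ne_zero hs0
    nlinarith
  obtain ⟨m, hm, hbm⟩ := NumberField.Embeddings.pow_eq_one_of_norm_le_one K ℂ (x := b)
    (by rintro rfl; simp at ha0)
    ((isIntegral_algebraMap_iff (algebraMap K ℂ).injective).1 ha) hφ
  refine Complex.eq_of_sum_eq_card_mul _ ?_ _ ?_ (by rw [Multiset.card_map]; exact h)
  · intro r hr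
    exact Complex.norm_eq_one_of_pow_eq_one (hs r hr) hn.ne'
  · refine Complex.norm_eq_one_of_pow_eq_one (n := m) ?_ hm.ne'
    rw [← map_pow, hbm, map_one]

/-! ### Complex matrices of finite order. -/

namespace Matrix

variable {d : ℕ}

theorem pow_eq_one_of_mem_roots_charpoly {n : ℕ} {M : Matrix (Fin d) (Fin d) ℂ} (hM : M ^ n = 1)
    {r : ℂ} (hr : r ∈ M.charpoly.roots) : r ^ n = 1 := by
  have h1 : r ∈ spectrum ℂ M := mem_spectrum_of_isRoot_charpoly (Polynomial.isRoot_of_mem_roots hr)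
  have h2 := spectrum.subset_polynomial_aeval M (Polynomial.X ^ n : Polynomial ℂ) ⟨r, h1, rfl⟩
  have : Nontrivial (Matrix (Fin d) (Fin d) ℂ) := by
    by_contra h
    rw [not_nontrivial_iff_subsingleton] at h
    rw [spectrum.of_subsingleton] at h1
    exact h1
  simpa [hM] using h2

theorem isIntegral_trace_of_pow_eq_one {n : ℕ} (hn : 0 < n) {M : Matrix (Fin d) (Fin d) ℂ}
    (hM : M ^ n = 1) : IsIntegral ℤ M.trace := by
  rw [trace_eq_sum_roots_charpoly]
  refine IsIntegral.multiset_sum fun r hr => IsIntegral.of_pow hn ?_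
  rw [pow_eq_one_of_mem_roots_charpoly hM hr]
  exact isIntegral_one

/-- A complex matrix of finite order is scalar if the average of its eigenvalues is a nonzero
algebraic integer. -/
theorem eq_scalar_of_isIntegral {n : ℕ} (hn : 0 < n) {M : Matrix (Fin d) (Fin d) ℂ}
    (hM : M ^ n = 1) {a : ℂ} (ha : IsIntegral ℤ a) (ha0 : a ≠ 0) (h : M.trace = d * a) :
    M = algebraMap ℂ _ a := by
  have hcard : M.charpoly.roots.card = d := by
    rw [← (IsAlgClosed.splits M.charpoly).natDegree_eq_card_roots, charpoly_natDegree_eq_dim,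
      Fintype.card_fin]
  have hroots := Complex.eq_of_isIntegral_average hn M.charpoly.roots
    (fun r hr => pow_eq_one_of_mem_roots_charpoly hM hr) a ha ha0
    (by rw [← trace_eq_sum_roots_charpoly, hcard, h])
  have hchar : M.charpoly = (Polynomial.X - Polynomial.C a) ^ d := by
    have h1 := (IsAlgClosed.splits M.charpoly).eq_prod_roots_of_monic M.charpoly_monic
    rw [Multiset.eq_replicate_card.2 hroots, hcard] at h1
    simpa using h1
  -- Finite order makes `M` diagonalizable: its minimal polynomial divides the separable `X ^ n -
  -- 1`. Dividing also `(X - a) ^ d`, it divides `X - a`.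
  have hsq : Squarefree (minpoly ℂ M) := by
    have h1 : minpoly ℂ M ∣ Polynomial.X ^ n - 1 := minpoly.dvd _ _ (by simp [hM])
    have h2 : (Polynomial.X ^ n - 1 : Polynomial ℂ).Separable := by
      refine Polynomial.separable_X_pow_sub_C 1 ?_ one_ne_zero
      exact_mod_cast hn.ne'
    exact h2.squarefree.squarefree_of_dvd h1
  have h1 : minpoly ℂ M ∣ (Polynomial.X - Polynomial.C a) ^ d := by
    rw [← hchar]
    exact minpoly_dvd_charpoly M
  rcases Nat.eq_zero_or_pos d with rfl | hd
  · exact Subsingleton.elim _ _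
  have h2 := (hsq.dvd_pow_iff_dvd hd.ne').1 h1
  have h3 := Polynomial.aeval_eq_zero_of_dvd_aeval_eq_zero h2 (minpoly.aeval ℂ M)
  simpa [sub_eq_zero] using h3

end Matrix

/-! ### The regular representation of a finite group. -/

section GroupAlgebra

variable {G : Type*} [Group G] [Finite G]

/-- Left multiplication acts on each of the `d i` columns of the `i`-th block as `b i`. -/
theorem LinearMap.trace_mulLeft_pi_matrix {n : ℕ} {d : Fin n → ℕ}
    (b : (i : Fin n) → Matrix (Fin (d i)) (Fin (d i)) ℂ) :
    LinearMap.trace ℂ _ (LinearMap.mulLeft ℂ b) = ∑ i, (d i : ℂ) * (b i).trace := by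
  classical
  rw [LinearMap.trace_eq_matrix_trace ℂ (Pi.basis fun i => Matrix.stdBasis ℂ (Fin (d i)) (Fin (d i))),
    Matrix.trace, Fintype.sum_sigma]
  refine Finset.sum_congr rfl fun i _ => ?_
  have h : ∀ x : Fin (d i) × Fin (d i),
      (LinearMap.toMatrix (Pi.basis fun i => Matrix.stdBasis ℂ (Fin (d i)) (Fin (d i)))
        (Pi.basis fun i => Matrix.stdBasis ℂ (Fin (d i)) (Fin (d i)))
        (LinearMap.mulLeft ℂ b)).diag ⟨i, x⟩ = b i x.1 x.1 := by
    rintro ⟨j, k⟩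
    rw [Matrix.diag_apply, LinearMap.toMatrix_apply, Pi.basis_repr, Pi.basis_apply,
      Matrix.stdBasis_eq_single, LinearMap.mulLeft_apply, Pi.mul_apply, Pi.single_eq_same]
    simp [Matrix.stdBasis]
  rw [Finset.sum_congr rfl fun x _ => h x, Fintype.sum_prod_type]
  simp [Matrix.trace, Finset.mul_sum]

theorem MonoidAlgebra.trace_mulLeft_single [DecidableEq G] (g : G) :
    LinearMap.trace ℂ _ (LinearMap.mulLeft ℂ (MonoidAlgebra.single g (1 : ℂ)))
      = if g = 1 then (Nat.card G : ℂ) else 0 := by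
  have := Fintype.ofFinite G
  rw [LinearMap.trace_eq_matrix_trace ℂ (MonoidAlgebra.basis G ℂ), Matrix.trace]
  have h : ∀ x : G, (LinearMap.toMatrix (MonoidAlgebra.basis G ℂ) (MonoidAlgebra.basis G ℂ)
      (LinearMap.mulLeft ℂ (MonoidAlgebra.single g (1 : ℂ)))).diag x = if g = 1 then 1 else 0 := by
    intro x
    rw [Matrix.diag_apply, LinearMap.toMatrix_apply, MonoidAlgebra.basis_apply,
      LinearMap.mulLeft_apply, MonoidAlgebra.single_mul_single, mul_one]
    change (Finsupp.single (g * x) (1 : ℂ)) x = _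
    simp [Finsupp.single_apply]
  rw [Finset.sum_congr rfl fun x _ => h x]
  split_ifs <;> simp

variable (G) in
/-- The irreducible complex matrix representations of a finite group: every matrix which commutes
with one of them is scalar, and they add up to the regular representation. -/
theorem exists_matrix_representations : ∃ (n : ℕ) (d : Fin n → ℕ)
    (Φ : (i : Fin n) → G →* Matrix (Fin (d i)) (Fin (d i)) ℂ),
    (∀ i, 0 < d i) ∧
    (∀ i M, (∀ g, Commute (Φ i g) M) → ∃ c : ℂ, M = algebraMap ℂ _ c) ∧
    (∑ i, (d i : ℂ) * (Φ i 1).trace = Nat.card G) ∧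
    ∀ g ≠ 1, ∑ i, (d i : ℂ) * (Φ i g).trace = 0 := by
  classical
  have : Module.Finite ℂ (MonoidAlgebra ℂ G) := Module.Finite.of_basis (MonoidAlgebra.basis G ℂ)
  obtain ⟨n, d, hd, ⟨e⟩⟩ :=
    IsSemisimpleRing.exists_algEquiv_pi_matrix_of_isAlgClosed ℂ (MonoidAlgebra ℂ G)
  let Φ : (i : Fin n) → G →* Matrix (Fin (d i)) (Fin (d i)) ℂ := fun i =>
    { toFun := fun g => e (MonoidAlgebra.single g 1) i
      map_one' := by rw [← MonoidAlgebra.one_def, map_one, Pi.one_apply]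
      map_mul' := fun g h => by
        rw [← Pi.mul_apply, ← map_mul, MonoidAlgebra.single_mul_single, mul_one] }
  have hΦ : ∀ i g, Φ i g = e (MonoidAlgebra.single g 1) i := fun i g => rfl
  have htr : ∀ g, ∑ i, (d i : ℂ) * (Φ i g).trace = if g = 1 then (Nat.card G : ℂ) else 0 := by
    intro g
    rw [← MonoidAlgebra.trace_mulLeft_single, ← LinearMap.trace_conj' _ e.toLinearEquiv]
    simp only [hΦ]
    rw [← LinearMap.trace_mulLeft_pi_matrix]
    congr 1
    refine LinearMap.ext fun x => ?_
    simp [LinearEquiv.conj_apply]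
  refine ⟨n, d, Φ, fun i => Nat.pos_of_ne_zero (hd i).out, ?_, by simpa using htr 1,
    fun g hg => by simpa [hg] using htr g⟩
  intro i M hM
  have h1 : ∀ a : MonoidAlgebra ℂ G, Commute (e a i) M := by
    intro a
    induction a using MonoidAlgebra.induction_on with
    | of g => exact hM g
    | add a b ha hb => rw [map_add]; exact ha.add_left hb
    | smul c a ha => rw [map_smul]; exact ha.smul_left c
  -- The Wedderburn isomorphism `e` is onto, so `M` commutes with every matrix unit of block `i`.
  obtain ⟨c, hc⟩ := Matrix.mem_range_scalar_of_commute_single (M := M) fun j k _ => by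
    have h2 := h1 (e.symm (Pi.single i (Matrix.single j k 1)))
    simpa using h2
  exact ⟨c, hc.symm⟩

end GroupAlgebra

/-! ### Central characters and classes of prime power size. -/

section CentralCharacter

variable {G : Type*} [Group G] [Finite G] {d : ℕ}

/-- The central character of an irreducible representation takes algebraic integers as values on
class sums. -/
theorem exists_isIntegral_card_mul_trace [Fintype G] [DecidableRel (IsConj (α := G))]
    (Φ : G →* Matrix (Fin d) (Fin d) ℂ) (hd : 0 < d)
    (hΦ : ∀ M, (∀ g, Commute (Φ g) M) → ∃ c : ℂ, M = algebraMap ℂ _ c) (g : G) :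
    ∃ w : ℂ, IsIntegral ℤ w ∧
      ((Finset.univ.filter (IsConj g)).card : ℂ) * (Φ g).trace = d * w := by
  have : NeZero d := ⟨hd.ne'⟩
  set C := Finset.univ.filter (IsConj g)
  obtain ⟨w, hw⟩ := hΦ (∑ h ∈ C, Φ h) fun k => by
    change _ * _ = _ * _
    rw [Finset.mul_sum, Finset.sum_mul]
    refine Finset.sum_nbij' (fun h => k * h * k⁻¹) (fun h => k⁻¹ * h * k) ?_ ?_ ?_ ?_ ?_
    · intro h hh
      simp only [C, Finset.mem_filter, Finset.mem_univ, true_and] at hh ⊢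
      exact hh.trans (isConj_iff.2 ⟨k, rfl⟩)
    · intro h hh
      simp only [C, Finset.mem_filter, Finset.mem_univ, true_and] at hh ⊢
      exact hh.trans (isConj_iff.2 ⟨k⁻¹, by simp⟩)
    · intro h _
      group
    · intro h _
      group
    · intro h _
      rw [← map_mul, ← map_mul]
      congr 1
      group
  refine ⟨w, ?_, ?_⟩
  -- The class sum already lives in the integral group ring, a finite `ℤ`-module, and is therefore
  -- integral.
  · have : Module.Finite ℤ (MonoidAlgebra ℤ G) := Module.Finite.of_basis (MonoidAlgebra.basis G ℤ)
    have h1 : IsIntegral ℤ (∑ h ∈ C, MonoidAlgebra.single h (1 : ℤ)) := IsIntegral.of_finite ℤ _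
    have h2 := h1.map (MonoidAlgebra.lift ℤ (Matrix (Fin d) (Fin d) ℂ) G Φ)
    rw [map_sum] at h2
    simp only [MonoidAlgebra.lift_single, one_smul] at h2
    rw [hw] at h2
    exact (isIntegral_algHom_iff (IsScalarTower.toAlgHom ℤ ℂ (Matrix (Fin d) (Fin d) ℂ))
      (algebraMap ℂ (Matrix (Fin d) (Fin d) ℂ)).injective).1 h2
  · have h1 := congrArg Matrix.trace hw
    rw [Matrix.trace_sum, Finset.sum_congr rfl (g := fun _ => (Φ g).trace), Finset.sum_const,
      nsmul_eq_mul] at h1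
    · rw [h1, Matrix.algebraMap_eq_diagonal]
      simp [Matrix.trace_diagonal]
    · intro h hh
      simp only [C, Finset.mem_filter, Finset.mem_univ, true_and] at hh
      obtain ⟨k, rfl⟩ := isConj_iff.1 hh
      rw [map_mul, Matrix.trace_mul_comm, ← map_mul]
      congr 2
      group

variable {n : ℕ} {e : Fin n → ℕ} (Φ : (i : Fin n) → G →* Matrix (Fin (e i)) (Fin (e i)) ℂ)

/-- The trivial representation occurs once in the regular representation. -/
theorem sum_sq_trivial_eq_one [DecidablePred fun i => ∀ g, Φ i g = 1] (he : ∀ i, 0 < e i)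
    (hΦ : ∀ i M, (∀ g, Commute (Φ i g) M) → ∃ c : ℂ, M = algebraMap ℂ _ c)
    (h1 : ∑ i, (e i : ℂ) * (Φ i 1).trace = Nat.card G)
    (h0 : ∀ g ≠ 1, ∑ i, (e i : ℂ) * (Φ i g).trace = 0) :
    ∑ i ∈ Finset.univ.filter (fun i => ∀ g, Φ i g = 1), (e i : ℂ) ^ 2 = 1 := by
  have := Fintype.ofFinite G
  have hs : ∑ i, (e i : ℂ) * (∑ g, Φ i g).trace = Nat.card G := by
    simp_rw [Matrix.trace_sum, Finset.mul_sum]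
    rw [Finset.sum_comm, Finset.sum_eq_single 1 (fun g _ hg => h0 g hg) (by simp), h1]
  -- The sum over the group absorbs every `Φ i k` and is scalar by irreducibility; a nonzero scalar
  -- could be cancelled, making `Φ i` trivial.
  have ht : ∀ i, (e i : ℂ) * (∑ g, Φ i g).trace
      = if ∀ g, Φ i g = 1 then (Nat.card G : ℂ) * (e i : ℂ) ^ 2 else 0 := by
    intro i
    have : NeZero (e i) := ⟨(he i).ne'⟩
    split_ifs with h
    · rw [Finset.sum_congr rfl fun g _ => h g, Finset.sum_const, Matrix.trace_smul,
        Matrix.trace_one, Finset.card_univ, nsmul_eq_mul, Fintype.card_fin,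
        Nat.card_eq_fintype_card]
      ring
    · push Not at h
      obtain ⟨g, hg⟩ := h
      have hl : ∀ k, Φ i k * ∑ g, Φ i g = ∑ g, Φ i g := by
        intro k
        rw [Finset.mul_sum]
        simp_rw [← map_mul]
        exact Fintype.sum_equiv (Equiv.mulLeft k) _ _ fun _ => rfl
      have hr : ∀ k, (∑ g, Φ i g) * Φ i k = ∑ g, Φ i g := by
        intro k
        rw [Finset.sum_mul]
        simp_rw [← map_mul]
        exact Fintype.sum_equiv (Equiv.mulRight k) _ _ fun _ => rfl
      obtain ⟨c, hc⟩ := hΦ i (∑ g, Φ i g) fun k => (hl k).trans (hr k).symm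
      have hc0 : c = 0 := by
        have h2 := hl g
        rw [hc, ← Algebra.commutes, ← Algebra.smul_def] at h2
        by_contra hc0
        apply hg
        have h3 := congrArg (fun M => c⁻¹ • M) h2
        simpa [smul_smul, hc0, Algebra.algebraMap_eq_smul_one] using h3
      rw [hc, hc0]
      simp
  simp_rw [ht] at hs
  rw [← Finset.sum_filter, ← Finset.mul_sum] at hs
  have hG : (Nat.card G : ℂ) ≠ 0 := by exact_mod_cast Nat.card_pos.ne'
  exact mul_left_cancel₀ hG (hs.trans (mul_one _).symm)

open Classical in
/-- An element `g ≠ 1` of a finite group whose conjugacy class has prime power order acts as a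
scalar in a nontrivial representation. -/
theorem exists_scalar_of_card_class_eq_prime_pow [Fintype G] {g : G} (hg : g ≠ 1) {q c : ℕ}
    (hq : q.Prime) (hc : (Finset.univ.filter (IsConj g)).card = q ^ c) :
    ∃ (d : ℕ) (Ψ : G →* Matrix (Fin d) (Fin d) ℂ),
      (∃ h, Ψ h ≠ 1) ∧ ∃ a : ℂ, Ψ g = algebraMap ℂ _ a := by
  obtain ⟨n, e, Φ, he, hΦ, h1, h0⟩ := exists_matrix_representations G
  have hord : ∀ i, Φ i g ^ orderOf g = 1 := fun i => by rw [← map_pow, pow_orderOf_eq_one, map_one]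
  -- Otherwise each nontrivial term of the regular character at `g` is `q` times an algebraic
  -- integer, while the trivial part contributes `1`. The total is `0`, so `-1 / q` would be an
  -- integer.
  obtain ⟨i, hi, hqi, hti⟩ : ∃ i, (∃ h, Φ i h ≠ 1) ∧ ¬ q ∣ e i ∧ (Φ i g).trace ≠ 0 := by
    by_contra! hcon
    have hterm : ∀ i, (¬ ∀ g, Φ i g = 1) → ∃ b : ℂ, IsIntegral ℤ b ∧
        (e i : ℂ) * (Φ i g).trace = q * b := by
      intro i hi
      rw [not_forall] at hi
      by_cases hqi : q ∣ e i
      · obtain ⟨k, hk⟩ := hqi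
        refine ⟨k * (Φ i g).trace, ?_, by
          rw [← mul_assoc, ← Nat.cast_mul, ← hk]⟩
        refine IsIntegral.mul ?_ (Matrix.isIntegral_trace_of_pow_eq_one (orderOf_pos g) (hord i))
        exact_mod_cast isIntegral_algebraMap (R := ℤ) (A := ℂ) (x := (k : ℤ))
      · exact ⟨0, isIntegral_zero, by rw [hcon i hi hqi]; ring⟩
    choose! b hb hbe using hterm
    have h2 := h0 g hg
    rw [← Finset.sum_filter_add_sum_filter_not _ (fun i => ∀ g, Φ i g = 1),
      Finset.sum_congr (g := fun i => q * b i) rfl fun i hi => hbe i (Finset.mem_filter.1 hi).2,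
      ← Finset.mul_sum] at h2
    have h3 : ∑ i ∈ Finset.univ.filter (fun i => ∀ g, Φ i g = 1), (e i : ℂ) * (Φ i g).trace = 1 := by
      rw [← sum_sq_trivial_eq_one Φ he hΦ h1 h0]
      refine Finset.sum_congr rfl fun i hi => ?_
      simp only [Finset.mem_filter, Finset.mem_univ, true_and] at hi
      rw [hi g]
      simp
      ring
    rw [h3] at h2
    have hint : IsIntegral ℤ (∑ i ∈ Finset.univ.filter (fun i => ¬ ∀ g, Φ i g = 1), b i) :=
      IsIntegral.sum _ fun i hi => hb i (Finset.mem_filter.1 hi).2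
    have hq0 : (q : ℂ) ≠ 0 := by exact_mod_cast hq.ne_zero
    have h4 : (∑ i ∈ Finset.univ.filter (fun i => ¬ ∀ g, Φ i g = 1), b i)
        = algebraMap ℚ ℂ (-1 / q) := by
      simp only [eq_ratCast, Rat.cast_div, Rat.cast_neg, Rat.cast_one, Rat.cast_natCast]
      field_simp
      linear_combination h2
    rw [h4, isIntegral_algebraMap_iff (algebraMap ℚ ℂ).injective,
      IsIntegrallyClosed.isIntegral_iff] at hint
    obtain ⟨y, hy⟩ := hint
    have hq0' : (q : ℚ) ≠ 0 := by exact_mod_cast hq.ne_zero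
    rw [eq_div_iff hq0'] at hy
    have hy' : y * q = -1 := by
      simp only [eq_intCast] at hy
      exact_mod_cast hy
    have h5 : (q : ℤ) ∣ 1 := ⟨-y, by linarith⟩
    exact hq.one_lt.ne' (by exact_mod_cast Int.eq_one_of_dvd_one (by positivity) h5)
  refine ⟨e i, Φ i, hi, ?_⟩
  obtain ⟨w, hw, hwe⟩ := exists_isIntegral_card_mul_trace (Φ i) (he i) (hΦ i) g
  rw [hc] at hwe
  have hcop : IsCoprime ((q ^ c : ℕ) : ℤ) (e i : ℤ) :=
    Nat.isCoprime_iff_coprime.2 (Nat.Coprime.pow_left _ ((Nat.Prime.coprime_iff_not_dvd hq).2 hqi))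
  -- Bézout expresses the average eigenvalue of `Φ i g` as an integral combination of the central
  -- character value `w` and the trace, hence as an algebraic integer.
  obtain ⟨u, v, huv⟩ := hcop
  have huv' : (u : ℂ) * ((q ^ c : ℕ) : ℂ) + v * e i = 1 := by
    exact_mod_cast congrArg (Int.cast : ℤ → ℂ) huv
  have he0 : (e i : ℂ) ≠ 0 := by exact_mod_cast (he i).ne'
  have hint : ∀ z : ℤ, IsIntegral ℤ (z : ℂ) := fun z =>
    isIntegral_algebraMap (R := ℤ) (A := ℂ) (x := z)
  have htr : (Φ i g).trace = e i * (u * w + v * (Φ i g).trace) := by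
    linear_combination (-(Φ i g).trace) * huv' + u * hwe
  refine ⟨u * w + v * (Φ i g).trace,
    Matrix.eq_scalar_of_isIntegral (orderOf_pos g) (hord i) ?_ ?_ htr⟩
  · exact ((hint u).mul hw).add ((hint v).mul
      (Matrix.isIntegral_trace_of_pow_eq_one (orderOf_pos g) (hord i)))
  · intro h
    rw [h, mul_zero] at htr
    exact hti htr

end CentralCharacter

/-! ### Coprime indices and Burnside's theorem. -/

/-- Coprimality forces `H.index` to divide the index of `H ⊓ K` in `K`, so `K` acts transitively on
`G ⧸ H`. -/
theorem Subgroup.exists_mul_eq_of_index_coprime {G : Type*} [Group G] [Finite G] {H K : Subgroup G}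
    (h : H.index.Coprime K.index) (g : G) : ∃ k ∈ K, ∃ x ∈ H, k * x = g := by
  have h1 : H.relIndex K * K.index = (H ⊓ K).index := by
    rw [← Subgroup.inf_relIndex_right]
    exact Subgroup.relIndex_mul_index inf_le_right
  have h2 : H.index ∣ H.relIndex K :=
    h.dvd_of_dvd_mul_right (h1 ▸ Subgroup.index_dvd_of_le inf_le_left)
  have h3 : H.relIndex K = Nat.card (G ⧸ H) := by
    refine le_antisymm ?_ (Nat.le_of_dvd (Nat.pos_of_ne_zero ?_) h2)
    · have := Subgroup.relIndex_le_of_le_right (H := H) (le_top : K ≤ ⊤)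
        (by rw [Subgroup.relIndex_top_right]; exact Subgroup.index_ne_zero_of_finite)
      rwa [Subgroup.relIndex_top_right] at this
    · exact Subgroup.index_ne_zero_of_finite
  have h4 : MulAction.stabilizer K ((1 : G) : G ⧸ H) = H.subgroupOf K := by
    ext k
    rw [MulAction.mem_stabilizer_iff, Subgroup.mem_subgroupOf]
    change ((k * 1 : G) : G ⧸ H) = _ ↔ _
    rw [mul_one, eq_comm, QuotientGroup.eq]
    simp
  have h5 : MulAction.orbit K ((1 : G) : G ⧸ H) = Set.univ := by
    refine Set.eq_of_subset_of_ncard_le (Set.subset_univ _) ?_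
    rw [Set.ncard_univ, ← MulAction.index_stabilizer, h4, ← h3]
    rfl
  obtain ⟨k, hk⟩ : (g : G ⧸ H) ∈ MulAction.orbit K ((1 : G) : G ⧸ H) := h5 ▸ Set.mem_univ _
  have hk' : ((k * 1 : G) : G ⧸ H) = g := hk
  rw [mul_one, QuotientGroup.eq] at hk'
  exact ⟨k, k.2, _, hk', by group⟩

/-- A nontrivial representation in which `g` is scalar is faithful, as there are no proper normal
subgroups. So `g` is central and the group is abelian. -/
theorem Group.isSolvable_of_card_class_eq_prime_pow {G : Type*} [Group G] [Finite G]
    (hN : ∀ N : Subgroup G, N.Normal → N = ⊥ ∨ N = ⊤) {g : G} (hg : g ≠ 1) {q c : ℕ}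
    (hq : q.Prime) (hc : (Subgroup.centralizer {g}).index = q ^ c) : Group.IsSolvable G := by
  classical
  have := Fintype.ofFinite G
  have hcard : (Finset.univ.filter (IsConj g)).card = q ^ c := by
    have h1 := MulAction.index_stabilizer (ConjAct G) g
    have h2 : MulAction.orbit (ConjAct G) g = (Finset.univ.filter (IsConj g) : Finset G) := by
      ext x
      rw [ConjAct.mem_orbit_conjAct, isConj_comm]
      simp
    rw [h2, Set.ncard_coe_finset] at h1
    have h3 := Subgroup.index_mul_card (MulAction.stabilizer (ConjAct G) g)
    have h4 := Subgroup.index_mul_card (Subgroup.centralizer {g})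
    rw [Subgroup.nat_card_centralizer_nat_card_stabilizer] at h4
    rw [← h1, ← hc]
    exact Nat.eq_of_mul_eq_mul_right Nat.card_pos (h3.trans h4.symm)
  obtain ⟨d, Ψ, ⟨h, hh⟩, a, ha⟩ := exists_scalar_of_card_class_eq_prime_pow hg hq hcard
  have hker : Ψ.ker = ⊥ := by
    refine (hN Ψ.ker inferInstance).resolve_right fun h1 => hh ?_
    exact MonoidHom.mem_ker.1 (h1 ▸ Subgroup.mem_top h)
  have hinj := (MonoidHom.ker_eq_bot_iff Ψ).1 hker
  have hz : g ∈ Subgroup.center G := by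
    rw [Subgroup.mem_center_iff]
    intro x
    apply hinj
    rw [map_mul, map_mul, ha, Algebra.commutes]
  have htop : Subgroup.center G = ⊤ := by
    refine (hN _ inferInstance).resolve_left fun h1 => hg ?_
    rwa [h1, Subgroup.mem_bot] at hz
  refine Group.isSolvable_of_comm fun x y => ?_
  exact (Subgroup.mem_center_iff.1 (htop ▸ Subgroup.mem_top y : y ∈ Subgroup.center G) x)

/-- **Burnside's theorem**: a finite group whose order has at most two prime divisors is
solvable. -/
theorem Group.isSolvable_of_prime_dvd_card {p q : ℕ} (n : ℕ) : ∀ (G : Type*) [Group G] [Finite G],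
    Nat.card G = n → (∀ r : ℕ, r.Prime → r ∣ Nat.card G → r = p ∨ r = q) → Group.IsSolvable G := by
  induction n using Nat.strong_induction_on with
  | _ n ih =>
  intro G _ _ hn hG
  by_cases hN : ∀ N : Subgroup G, N.Normal → N = ⊥ ∨ N = ⊤
  · by_cases h1 : Nat.card G = 1
    · have := (Nat.card_eq_one_iff_unique.1 h1).1
      infer_instance
    obtain ⟨r, hr, hrG⟩ := Nat.exists_prime_and_dvd h1
    have : Fact r.Prime := ⟨hr⟩
    obtain ⟨P⟩ : Nonempty (Sylow r G) := inferInstance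
    have hP := P.ne_bot_of_dvd_card hrG
    have : Nontrivial (P : Subgroup G) := (Subgroup.nontrivial_iff_ne_bot _).2 hP
    have := P.2.center_nontrivial
    -- The centralizer of `z` contains the Sylow `r`-subgroup `P`, so the size of its class is prime
    -- to `r` and is a power of the other prime.
    obtain ⟨z, hz⟩ := exists_ne (1 : Subgroup.center (P : Subgroup G))
    have hz1 : ((z : (P : Subgroup G)) : G) ≠ 1 := by simpa using hz
    have hle : (P : Subgroup G) ≤ Subgroup.centralizer {((z : (P : Subgroup G)) : G)} := by
      intro x hx
      rw [Subgroup.mem_centralizer_singleton_iff]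
      exact congrArg Subtype.val (Subgroup.mem_center_iff.1 z.2 ⟨x, hx⟩)
    have hdvd := Subgroup.index_dvd_of_le hle
    have hrd : ¬ r ∣ (Subgroup.centralizer {((z : (P : Subgroup G)) : G)}).index := fun h =>
      P.not_dvd_index (h.trans hdvd)
    by_cases h2 : (Subgroup.centralizer {((z : (P : Subgroup G)) : G)}).index = 1
    · exact isSolvable_of_card_class_eq_prime_pow hN hz1 hr (c := 0)
        (by rw [h2, pow_zero])
    obtain ⟨s, hs, hsd⟩ := Nat.exists_prime_and_dvd h2
    refine isSolvable_of_card_class_eq_prime_pow hN hz1 hs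
      (Nat.eq_prime_pow_of_unique_prime_dvd Subgroup.index_ne_zero_of_finite fun {t} ht htd => ?_)
    have hsr : s ≠ r := fun h => hrd (h ▸ hsd)
    have htr : t ≠ r := fun h => hrd (h ▸ htd)
    have e1 := hG r hr hrG
    have e2 := hG s hs (hsd.trans (Subgroup.index_dvd_card _))
    have e3 := hG t ht (htd.trans (Subgroup.index_dvd_card _))
    grind
  · push Not at hN
    obtain ⟨N, hNn, hb, ht⟩ := hN
    have hmul := Subgroup.index_mul_card N
    have hc1 : 1 < Nat.card N := by
      have := (Subgroup.nontrivial_iff_ne_bot N).2 hb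
      exact Finite.one_lt_card
    have hi1 : 1 < N.index := by
      have h1 : N.index ≠ 0 := Subgroup.index_ne_zero_of_finite
      have h2 : N.index ≠ 1 := fun h => ht (Subgroup.index_eq_one.1 h)
      omega
    refine (isSolvable_iff_subgroup_quotient N).2 ⟨ih (Nat.card N) ?_ N rfl ?_,
      ih (Nat.card (G ⧸ N)) ?_ (G ⧸ N) rfl ?_⟩
    · rw [← hn, ← hmul]
      exact lt_mul_left Nat.card_pos hi1
    · exact fun r hr hrd => hG r hr (hrd.trans (Subgroup.card_subgroup_dvd_card N))
    · rw [← hn, ← hmul, ← Subgroup.index_eq_card]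
      exact lt_mul_right (by omega) hc1
    · exact fun r hr hrd => hG r hr (hrd.trans (Subgroup.index_dvd_card N))

/-! ### Finite solvable groups and Wielandt's theorem. -/

/-- The last nontrivial derived subgroup is abelian; its Sylow subgroups are characteristic in it
and hence normal in `G`. -/
theorem Group.IsSolvable.exists_normal_isPGroup (G : Type*) [Group G] [Finite G] [Nontrivial G]
    [Group.IsSolvable G] :
    ∃ (p : ℕ) (N : Subgroup G), p.Prime ∧ N.Normal ∧ N ≠ ⊥ ∧ IsPGroup p N := by
  classical
  have hex := Group.IsSolvable.solvable (G := G)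
  obtain ⟨n, hn⟩ : ∃ n, Nat.find hex = n + 1 := by
    refine Nat.exists_eq_succ_of_ne_zero fun h => ?_
    have h1 := Nat.find_spec hex
    rw [h, derivedSeries_zero] at h1
    exact bot_ne_top h1.symm
  have hD : derivedSeries G n ≠ ⊥ := Nat.find_min hex (by omega)
  have hD1 : derivedSeries G (n + 1) = ⊥ := hn ▸ Nat.find_spec hex
  set D := derivedSeries G n
  have hcomm : ∀ x y : D, x * y = y * x := by
    intro x y
    have h1 := Subgroup.commutator_mem_commutator x.2 y.2
    rw [← derivedSeries_succ, hD1, Subgroup.mem_bot, commutatorElement_eq_one_iff_mul_comm] at h1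
    exact Subtype.ext h1
  have : Nontrivial D := (Subgroup.nontrivial_iff_ne_bot _).2 hD
  obtain ⟨p, hp, hpD⟩ := Nat.exists_prime_and_dvd (Finite.one_lt_card (α := D)).ne'
  have : Fact p.Prime := ⟨hp⟩
  obtain ⟨P⟩ : Nonempty (Sylow p D) := inferInstance
  have hPn : (P : Subgroup D).Normal := ⟨fun a ha g => by rwa [hcomm g a, mul_inv_cancel_right]⟩
  have := P.characteristic_of_normal hPn
  refine ⟨p, (P : Subgroup D).map D.subtype, hp, inferInstance, ?_, P.2.map _⟩
  rw [Ne, Subgroup.map_eq_bot_iff_of_injective _ D.subtype_injective]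
  exact P.ne_bot_of_dvd_card hpD

/-- A proper subgroup of a finite solvable group is contained in a proper subgroup of prime power
index. -/
theorem Group.IsSolvable.exists_index_eq_prime_pow (n : ℕ) : ∀ (G : Type*) [Group G] [Finite G]
    [Group.IsSolvable G] (M : Subgroup G), Nat.card G = n → M ≠ ⊤ →
    ∃ (K : Subgroup G) (p a : ℕ), M ≤ K ∧ K ≠ ⊤ ∧ p.Prime ∧ K.index = p ^ a := by
  induction n using Nat.strong_induction_on with
  | _ n ih =>
  intro G _ _ _ M hn hM
  have : Nontrivial G := by
    by_contra h
    rw [not_nontrivial_iff_subsingleton] at h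
    exact hM (Subsingleton.elim _ _)
  obtain ⟨p, N, hp, hN, hNb, hNp⟩ := Group.IsSolvable.exists_normal_isPGroup G
  -- If `M` and `N` generate `G`, the index of `M` equals that of `M ⊓ N` in the `p`-group `N`.
  -- Otherwise `M` stays proper in `G ⧸ N`.
  by_cases hMN : M ⊔ N = ⊤
  · have : Fact p.Prime := ⟨hp⟩
    obtain ⟨a, ha⟩ := hNp.index (M.subgroupOf N)
    refine ⟨M, p, a, le_rfl, hM, hp, ?_⟩
    have h1 := Subgroup.relIndex_mul_index (inf_le_right : M ⊓ N ≤ N)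
    have h2 := Subgroup.relIndex_mul_index (inf_le_left : M ⊓ N ≤ M)
    have h3 := Subgroup.relIndex_sup_right (H := M) (K := N)
    rw [hMN, Subgroup.relIndex_top_right] at h3
    rw [Subgroup.inf_relIndex_right] at h1
    rw [Subgroup.inf_relIndex_left, ← h1, ← h3, mul_comm] at h2
    rw [← ha]
    exact Nat.eq_of_mul_eq_mul_right (Nat.pos_of_ne_zero Subgroup.index_ne_zero_of_finite) h2
  · have hlt : Nat.card (G ⧸ N) < n := by
      rw [← hn, ← Subgroup.index_mul_card N, ← Subgroup.index_eq_card]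
      have := (Subgroup.nontrivial_iff_ne_bot N).2 hNb
      exact lt_mul_right (Nat.pos_of_ne_zero Subgroup.index_ne_zero_of_finite) Finite.one_lt_card
    have hsurj := QuotientGroup.mk'_surjective N
    obtain ⟨K, r, a, hK, hKt, hr, hKi⟩ := ih _ hlt (G ⧸ N) (M.map (QuotientGroup.mk' N)) rfl (by
      intro h
      apply hMN
      have h1 := Subgroup.comap_map_eq (QuotientGroup.mk' N) M
      rwa [h, Subgroup.comap_top, QuotientGroup.ker_mk', eq_comm] at h1)
    refine ⟨K.comap (QuotientGroup.mk' N), r, a, Subgroup.map_le_iff_le_comap.1 hK, ?_, hr, ?_⟩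
    · intro h
      apply hKt
      rw [← Subgroup.map_comap_eq_self_of_surjective hsurj K, h,
        Subgroup.map_top_of_surjective _ hsurj]
    · rw [Subgroup.index_comap_of_surjective _ hsurj, hKi]

/-- Some conjugate of `K` contains a Sylow `p`-subgroup above `N`. As `G` is the product of this
conjugate and `H`, which normalizes `N`, the normal closure of `N` stays inside the conjugate. -/
theorem Subgroup.exists_solvable_normal {G : Type*} [Group G] [Finite G] {H K N : Subgroup G}
    [Group.IsSolvable K] (hHK : H.index.Coprime K.index) {p : ℕ} (hp : p.Prime)
    (hNp : IsPGroup p N) (hN : N ≠ ⊥) (hHN : ∀ h ∈ H, ∀ x ∈ N, h * x * h⁻¹ ∈ N)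
    (hpK : ¬ p ∣ K.index) : ∃ L : Subgroup G, L.Normal ∧ L ≠ ⊥ ∧ Group.IsSolvable L := by
  have : Fact p.Prime := ⟨hp⟩
  obtain ⟨Q⟩ : Nonempty (Sylow p K) := inferInstance
  obtain ⟨S, hS⟩ := hNp.exists_le_sylow
  have hQi : ¬ p ∣ ((Q : Subgroup K).map K.subtype).index := by
    rw [Subgroup.index_map_subtype, hp.dvd_mul, not_or]
    exact ⟨Q.not_dvd_index, hpK⟩
  obtain ⟨g, hg⟩ := MulAction.exists_smul_eq G ((Q.2.map K.subtype).toSylow hQi) S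
  have hSK : ∀ x ∈ (S : Subgroup G), g⁻¹ * x * g ∈ K := by
    intro x hx
    rw [← hg, Sylow.coe_subgroup_smul, Subgroup.mem_smul_pointwise_iff_exists] at hx
    obtain ⟨_, ⟨k, -, rfl⟩, rfl⟩ := hx
    simp [mul_assoc]
  let φ : K →* G := (MulAut.conj g).toMonoidHom.comp K.subtype
  have hφ : ∀ x, x ∈ φ.range ↔ g⁻¹ * x * g ∈ K := by
    intro x
    constructor
    · rintro ⟨k, rfl⟩
      simp [φ, mul_assoc]
    · intro h
      exact ⟨⟨_, h⟩, by simp [φ, mul_assoc]⟩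
  have hcop : H.index.Coprime φ.range.index := by
    rw [MonoidHom.range_comp, K.range_subtype]
    have h := Subgroup.index_map_equiv K (MulAut.conj g)
    exact h ▸ hHK
  refine ⟨Subgroup.normalClosure N, inferInstance, ?_, ?_⟩
  · intro h
    apply hN
    rw [eq_bot_iff, ← h]
    exact Subgroup.le_normalClosure
  have hle : Subgroup.normalClosure (N : Set G) ≤ φ.range := by
    rw [Subgroup.normalClosure, Subgroup.closure_le]
    intro y hy
    obtain ⟨x, hx, hxy⟩ := Group.mem_conjugatesOfSet_iff.1 hy
    obtain ⟨c, rfl⟩ := isConj_iff.1 hxy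
    obtain ⟨k, hk, h, hh, rfl⟩ := Subgroup.exists_mul_eq_of_index_coprime hcop c
    have h1 : h * x * h⁻¹ ∈ φ.range := (hφ _).2 (hSK _ (hS (hHN h hh x hx)))
    have h2 : k * h * x * (k * h)⁻¹ = k * (h * x * h⁻¹) * k⁻¹ := by group
    rw [h2]
    exact mul_mem (mul_mem hk h1) (inv_mem hk)
  have : Group.IsSolvable φ.range := Group.isSolvable_of_surjective φ.rangeRestrict_surjective
  exact Group.isSolvable_of_isSolvable_injective (Subgroup.inclusion_injective hle)

/-- **Wielandt's theorem**: a finite group with three solvable subgroups of pairwise coprime indices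
is solvable. -/
theorem Group.isSolvable_of_coprime_index (n : ℕ) : ∀ (G : Type*) [Group G] [Finite G]
    (H K L : Subgroup G) [Group.IsSolvable H] [Group.IsSolvable K] [Group.IsSolvable L],
    Nat.card G = n → H.index.Coprime K.index → H.index.Coprime L.index → K.index.Coprime L.index →
    Group.IsSolvable G := by
  induction n using Nat.strong_induction_on with
  | _ n ih =>
  intro G _ _ H K L _ _ _ hn hHK hHL hKL
  by_cases hH : H = ⊥
  · subst hH
    have hK : K = ⊤ := by
      rw [← Subgroup.index_eq_one]
      rw [Subgroup.index_bot] at hHK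
      exact Nat.eq_one_of_dvd_coprimes hHK (Subgroup.index_dvd_card K) dvd_rfl
    subst hK
    exact isSolvable_of_surjective (f := (⊤ : Subgroup G).subtype)
      fun x => ⟨⟨x, Subgroup.mem_top x⟩, rfl⟩
  have : Nontrivial H := (Subgroup.nontrivial_iff_ne_bot _).2 hH
  obtain ⟨p, N, hp, hN, hNb, hNp⟩ := Group.IsSolvable.exists_normal_isPGroup H
  have hNb' : N.map H.subtype ≠ ⊥ := by
    rwa [Ne, Subgroup.map_eq_bot_iff_of_injective _ H.subtype_injective]
  have hHN : ∀ h ∈ H, ∀ x ∈ N.map H.subtype, h * x * h⁻¹ ∈ N.map H.subtype := by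
    rintro h hh _ ⟨x, hx, rfl⟩
    exact ⟨_, hN.conj_mem x hx ⟨h, hh⟩, rfl⟩
  -- The prime `p` cannot divide both `K.index` and `L.index`, so one of `K`, `L` serves; induction
  -- then applies to `G ⧸ R`.
  obtain ⟨R, hR, hRb, hRs⟩ : ∃ R : Subgroup G, R.Normal ∧ R ≠ ⊥ ∧ Group.IsSolvable R := by
    by_cases hpK : p ∣ K.index
    · exact Subgroup.exists_solvable_normal hHL hp (hNp.map _) hNb' hHN fun hpL =>
        hp.one_lt.ne' (Nat.eq_one_of_dvd_coprimes hKL hpK hpL)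
    · exact Subgroup.exists_solvable_normal hHK hp (hNp.map _) hNb' hHN hpK
  have hsurj := QuotientGroup.mk'_surjective R
  have hsol : ∀ U : Subgroup G, Group.IsSolvable U →
      Group.IsSolvable (U.map (QuotientGroup.mk' R)) := fun U _ =>
    isSolvable_of_surjective ((QuotientGroup.mk' R).subgroupMap_surjective U)
  have := hsol H inferInstance
  have := hsol K inferInstance
  have := hsol L inferInstance
  have hcop : ∀ {U V : Subgroup G}, U.index.Coprime V.index →
      (U.map (QuotientGroup.mk' R)).index.Coprime (V.map (QuotientGroup.mk' R)).index := fun h =>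
    (h.coprime_dvd_left (Subgroup.index_map_dvd _ hsurj)).coprime_dvd_right
      (Subgroup.index_map_dvd _ hsurj)
  refine (isSolvable_iff_subgroup_quotient R).2 ⟨hRs, ?_⟩
  refine ih (Nat.card (G ⧸ R)) ?_ (G ⧸ R) (H.map (QuotientGroup.mk' R))
    (K.map (QuotientGroup.mk' R)) (L.map (QuotientGroup.mk' R)) rfl (hcop hHK) (hcop hHL) (hcop hKL)
  rw [← hn, ← Subgroup.index_mul_card R, ← Subgroup.index_eq_card]
  have := (Subgroup.nontrivial_iff_ne_bot R).2 hRb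
  exact lt_mul_right (Nat.pos_of_ne_zero Subgroup.index_ne_zero_of_finite) Finite.one_lt_card

/-! ### Finite left braces: solvability and Rump's theorem. -/

namespace LeftBrace

variable {B : Type*} [LeftBrace B]

theorem one_eq_zero : (1 : B) = 0 := by simpa using (mul_zero_eq (1 : B)).symm

theorem mul_eq_add_lambdaAut (x y : B) : x * y = x + lambdaAut x y := by
  change x * y = x + (-x + x * y)
  abel

theorem lambdaAut_mul (x y z : B) : lambdaAut (x * y) z = lambdaAut x (lambdaAut y z) := by
  have h1 := mul_eq_add_lambdaAut (x * y) z
  rw [mul_assoc, mul_eq_add_lambdaAut x (y * z), mul_eq_add_lambdaAut y z, map_add, ← add_assoc,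
    ← mul_eq_add_lambdaAut] at h1
  exact (add_left_cancel h1).symm

theorem lambdaAut_one (z : B) : lambdaAut (1 : B) z = z := by
  have h1 := mul_eq_add_lambdaAut 1 z
  rw [one_mul, one_eq_zero, zero_add] at h1
  rw [one_eq_zero]
  exact h1.symm

theorem add_eq_mul_lambdaAut_inv (x y : B) : x + y = x * lambdaAut x⁻¹ y := by
  rw [mul_eq_add_lambdaAut, ← lambdaAut_mul, mul_inv_cancel, lambdaAut_one]

variable (B) in
/-- The left ideal of a left brace which consists of the elements of additive order dividing `m`,
as a multiplicative subgroup. -/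
def torsionSubgroup (m : ℕ) : Subgroup B where
  carrier := {a | m • a = 0}
  one_mem' := by
    change m • (1 : B) = 0
    rw [one_eq_zero, smul_zero]
  mul_mem' {a b} (ha : m • a = 0) (hb : m • b = 0) := by
    change m • (a * b) = 0
    rw [mul_eq_add_lambdaAut, smul_add, ha, ← map_nsmul, hb, map_zero, add_zero]
  inv_mem' {a} (ha : m • a = 0) := by
    change m • a⁻¹ = 0
    apply (lambdaAut a).injective
    have h := mul_eq_add_lambdaAut a a⁻¹
    rw [mul_inv_cancel, one_eq_zero] at h
    rw [map_nsmul, ← neg_eq_of_add_eq_zero_right h.symm, smul_neg, ha, neg_zero, map_zero]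

theorem mem_torsionSubgroup {m : ℕ} {a : B} : a ∈ torsionSubgroup B m ↔ m • a = 0 := Iff.rfl

theorem nsmul_eq_pow {a : B} (ha : lambdaAut a a = a) (n : ℕ) : n • a = a ^ n := by
  induction n with
  | zero => rw [zero_smul, pow_zero, one_eq_zero]
  | succ n ih =>
    rw [pow_succ', ← ih, mul_eq_add_lambdaAut, map_nsmul, ha, succ_nsmul']

variable [Finite B]

/-- By Cauchy's theorem the kernels of multiplication by `m` and by `k` have orders dividing `m` and
`k`. The image of `m` lies in the kernel of `k`, so comparing with `m * k` gives equality. -/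
theorem card_torsionSubgroup {m k : ℕ} (hmk : m * k = Nat.card B) (hc : m.Coprime k) :
    Nat.card (torsionSubgroup B m) = m := by
  have hB : 0 < Nat.card B := Nat.card_pos
  let f : ℕ → B →+ B := fun n => nsmulAddMonoidHom n
  have hdvd : ∀ {m k : ℕ}, m * k = Nat.card B → m.Coprime k → Nat.card (f m).ker ∣ m := by
    intro m k hmk hc
    have h1 : Nat.card (f m).ker ∣ m * k := hmk ▸ AddSubgroup.card_addSubgroup_dvd_card _
    refine Nat.Coprime.dvd_of_dvd_mul_right (Nat.coprime_of_dvd ?_) h1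
    intro r hr hra hrk
    have : Fact r.Prime := ⟨hr⟩
    obtain ⟨⟨x, hx⟩, hxr⟩ := exists_prime_addOrderOf_dvd_card' r hra
    have h2 : addOrderOf x ∣ m := addOrderOf_dvd_of_nsmul_eq_zero hx
    rw [AddSubgroup.addOrderOf_mk] at hxr
    exact hr.one_lt.ne' (Nat.eq_one_of_dvd_coprimes hc (hxr ▸ h2) hrk)
  have hm := hdvd hmk hc
  have hk := hdvd ((mul_comm k m).trans hmk) hc.symm
  have hr : Nat.card (f m).range ≤ Nat.card (f k).ker := by
    refine Nat.card_mono (Set.toFinite _) ?_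
    rintro _ ⟨a, rfl⟩
    change k • (m • a) = 0
    rw [smul_smul, mul_comm, hmk, card_nsmul_eq_zero']
  have h1 : Nat.card (f m).ker * Nat.card (f m).range = m * k := by
    rw [hmk, ← AddSubgroup.card_mul_index (f m).ker, AddSubgroup.index_ker]
  have hm0 : 0 < m := Nat.pos_of_ne_zero (by rintro rfl; omega)
  have hk0 : 0 < k := Nat.pos_of_ne_zero (by rintro rfl; omega)
  change Nat.card (f m).ker = m
  have h2 := Nat.le_of_dvd hm0 hm
  have h3 := Nat.le_of_dvd hk0 hk
  refine le_antisymm h2 (Nat.le_of_mul_le_mul_right ?_ hk0)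
  rw [← h1]
  exact Nat.mul_le_mul_left _ (hr.trans h3)

/-- With at most two primes this is Burnside's theorem. With three, removing one primary part at a
time gives three subgroups of pairwise coprime prime power indices, solvable by induction, and
Wielandt's theorem applies. -/
theorem torsionSubgroup_isSolvable (n : ℕ) : ∀ k : ℕ, n * k = Nat.card B → n.Coprime k →
    Group.IsSolvable (torsionSubgroup B n) := by
  induction n using Nat.strong_induction_on with
  | _ n ih =>
  intro k hnk hc
  have hcard := card_torsionSubgroup hnk hc
  have hB : 0 < Nat.card B := Nat.card_pos
  have hn0 : n ≠ 0 := by rintro rfl; omega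
  by_cases h : ∃ p q : ℕ, ∀ r : ℕ, r.Prime → r ∣ n → r = p ∨ r = q
  · obtain ⟨p, q, h⟩ := h
    exact Group.isSolvable_of_prime_dvd_card _ _ rfl (by rwa [hcard])
  push Not at h
  have hsub : ∀ p : ℕ, p.Prime → p ∣ n → ∃ H : Subgroup (torsionSubgroup B n),
      Group.IsSolvable H ∧ ∃ a, H.index = p ^ a := by
    intro p hp hpn
    obtain ⟨a, m, hpm, hm⟩ := Nat.exists_eq_pow_mul_and_not_dvd hn0 p hp.ne_one
    have ha : a ≠ 0 := by
      rintro rfl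
      rw [pow_zero, one_mul] at hm
      exact hpm (hm ▸ hpn)
    have hm0 : 0 < m := Nat.pos_of_ne_zero (by rintro rfl; exact hpm (dvd_zero p))
    have hle : torsionSubgroup B m ≤ torsionSubgroup B n := by
      intro x hx
      rw [mem_torsionSubgroup] at hx ⊢
      rw [hm, mul_smul, hx, smul_zero]
    have hmk : m * (p ^ a * k) = Nat.card B := by rw [← hnk, hm]; ring
    have hmc : m.Coprime (p ^ a * k) := by
      refine Nat.Coprime.mul_right ?_ ?_
      · exact ((Nat.Prime.coprime_iff_not_dvd hp).2 hpm).symm.pow_right a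
      · exact Nat.Coprime.coprime_dvd_left (hm ▸ dvd_mul_left _ _) hc
    have hsol := ih m (by
      rw [hm]
      exact lt_mul_left hm0 (Nat.one_lt_pow ha hp.one_lt)) _ hmk hmc
    refine ⟨(torsionSubgroup B m).subgroupOf (torsionSubgroup B n), ?_, a, ?_⟩
    · exact Group.isSolvable_of_surjective (f := (Subgroup.subgroupOfEquivOfLe hle).symm.toMonoidHom)
        (Subgroup.subgroupOfEquivOfLe hle).symm.surjective
    · have h1 := Subgroup.index_mul_card
        ((torsionSubgroup B m).subgroupOf (torsionSubgroup B n))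
      rw [hcard, Nat.card_congr (Subgroup.subgroupOfEquivOfLe hle).toEquiv,
        card_torsionSubgroup hmk hmc] at h1
      exact Nat.eq_of_mul_eq_mul_right hm0 (h1.trans hm)
  -- The zeros exclude nothing, as `0` is not prime.
  obtain ⟨p, hp, hpn, -, -⟩ := h 0 0
  obtain ⟨q, hq, hqn, hqp, -⟩ := h p p
  obtain ⟨r, hr, hrn, hrp, hrq⟩ := h p q
  obtain ⟨H, _, a, ha⟩ := hsub p hp hpn
  obtain ⟨K, _, b, hb⟩ := hsub q hq hqn
  obtain ⟨L, _, c, hc⟩ := hsub r hr hrn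
  refine Group.isSolvable_of_coprime_index _ _ H K L rfl ?_ ?_ ?_
  · rw [ha, hb]
    exact Nat.coprime_pow_primes _ _ hp hq hqp.symm
  · rw [ha, hc]
    exact Nat.coprime_pow_primes _ _ hp hr hrp.symm
  · rw [hb, hc]
    exact Nat.coprime_pow_primes _ _ hq hr hrq.symm

variable (B) in
/-- The multiplicative group of a finite left brace is solvable. -/
theorem isSolvable : Group.IsSolvable B := by
  have := torsionSubgroup_isSolvable (B := B) (Nat.card B) 1 (mul_one _) (Nat.coprime_one_right _)
  exact Group.isSolvable_of_surjective (f := (torsionSubgroup B (Nat.card B)).subtype)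
    fun x => ⟨⟨x, card_nsmul_eq_zero'⟩, rfl⟩

/-- **Rump's decomposition theorem** in terms of left braces. -/
theorem subsingleton_of_smul_eq_self {X : Type*} [MulAction B X] [MulAction.IsPretransitive B X]
    (ρ : X → B) (hρ : ∀ b x, ρ (b • x) = lambdaAut b (ρ x))
    (hgen : AddSubgroup.closure (Set.range ρ) = ⊤) (hfix : ∀ x, ρ x • x = x) :
    Subsingleton X := by
  by_contra hX
  rw [not_subsingleton_iff_nontrivial] at hX
  obtain ⟨x₀, x₁, hx⟩ := hX
  have := isSolvable B
  have hM : MulAction.stabilizer B x₀ ≠ ⊤ := by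
    intro h
    obtain ⟨b, hb⟩ := MulAction.exists_smul_eq B x₀ x₁
    have h1 : b ∈ MulAction.stabilizer B x₀ := h ▸ Subgroup.mem_top b
    exact hx (h1.symm.trans hb)
  obtain ⟨K, p, a, hMK, hK, hp, hKi⟩ :=
    Group.IsSolvable.exists_index_eq_prime_pow _ B (MulAction.stabilizer B x₀) rfl hM
  have : Fact p.Prime := ⟨hp⟩
  have ha : a ≠ 0 := by
    rintro rfl
    exact hK (Subgroup.index_eq_one.1 hKi)
  obtain ⟨e, k, hpk, hek⟩ :=
    Nat.exists_eq_pow_mul_and_not_dvd (Nat.card_pos (α := B)).ne' p hp.ne_one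
  have hck : (p ^ e).Coprime k := ((Nat.Prime.coprime_iff_not_dvd hp).2 hpk).pow_left e
  set P := torsionSubgroup B (p ^ e)
  have hPc : Nat.card P = p ^ e := card_torsionSubgroup hek.symm hck
  have hPi : P.index = k := by
    have h1 := Subgroup.card_mul_index P
    rw [hPc, hek] at h1
    exact Nat.eq_of_mul_eq_mul_left (pow_pos hp.pos e) h1
  have hPp : IsPGroup p P := IsPGroup.of_card hPc
  have hKP : K.index.Coprime P.index := by
    rw [hKi, hPi]
    exact ((Nat.Prime.coprime_iff_not_dvd hp).2 hpk).pow_left a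
  have hL : K.subgroupOf P ≠ ⊤ := by
    intro h
    have h1 := Subgroup.index_dvd_of_le (Subgroup.subgroupOf_eq_top.1 h)
    rw [hKi, hPi] at h1
    exact hpk ((dvd_pow_self p ha).trans h1)
  obtain ⟨N, hN, hLN⟩ := (eq_top_or_exists_le_coatom (K.subgroupOf P)).resolve_left hL
  have := hPp.isNilpotent
  have hNn : N.Normal :=
    Subgroup.NormalizerCondition.normal_of_coatom N Group.normalizerCondition_of_isNilpotent hN
  -- `B` is the product of `P` and `K`, so conjugates of `K` are conjugates by elements of `P`,
  -- which normalizes `N`.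
  have hconj : ∀ (g : B) (y : P), g⁻¹ * y * g ∈ K → y ∈ N := by
    intro g y hy
    obtain ⟨u, hu, c, hc, rfl⟩ := Subgroup.exists_mul_eq_of_index_coprime hKP g
    have h1 : u⁻¹ * y * u ∈ K := by
      have h2 : u⁻¹ * y * u = c * ((u * c)⁻¹ * y * (u * c)) * c⁻¹ := by group
      rw [h2]
      exact mul_mem (mul_mem hc hy) (inv_mem hc)
    have h3 : (⟨u, hu⟩ : P)⁻¹ * y * ⟨u, hu⟩ ∈ N := hLN (Subgroup.mem_subgroupOf.2 h1)
    have h4 := hNn.conj_mem _ h3 ⟨u, hu⟩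
    simpa [mul_assoc] using h4
  -- Since `ρ x` fixes `x`, its additive multiples are its powers. So `k • ρ x` also fixes `x` and
  -- lies in a conjugate of `K`.
  have hρN : ∀ x, k • ρ x ∈ N.map P.subtype := by
    intro x
    have hP : k • ρ x ∈ P := by
      rw [mem_torsionSubgroup, smul_smul, ← hek, card_nsmul_eq_zero']
    obtain ⟨g, rfl⟩ := MulAction.exists_smul_eq B x₀ x
    refine ⟨⟨_, hP⟩, hconj g _ (hMK ?_), rfl⟩
    rw [MulAction.mem_stabilizer_iff, mul_smul, mul_smul, inv_smul_eq_iff]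
    change (k • ρ (g • x₀)) • g • x₀ = g • x₀
    rw [nsmul_eq_pow (by rw [← hρ, hfix])]
    have h1 : ρ (g • x₀) ∈ MulAction.stabilizer B (g • x₀) := hfix _
    exact pow_mem h1 k
  -- By `key`, adding `k • ρ x` amounts to multiplying by an element of `N`. As the `ρ x` generate
  -- `(B, +)`, `N` absorbs all of `k • B`, which is `P`.
  have hadd : ∀ b : B, ∀ a ∈ N.map P.subtype,
      a + k • b ∈ N.map P.subtype ∧ a - k • b ∈ N.map P.subtype := by
    intro b
    have hb : b ∈ AddSubgroup.closure (Set.range ρ) := hgen ▸ AddSubgroup.mem_top b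
    have key : ∀ (a : B) (x : X), a + k • ρ x = a * k • ρ (a⁻¹ • x) := by
      intro a x
      rw [add_eq_mul_lambdaAut_inv, map_nsmul, hρ]
    induction hb using AddSubgroup.closure_induction with
    | mem b hb =>
      obtain ⟨x, rfl⟩ := hb
      intro a ha
      refine ⟨?_, ?_⟩
      · rw [key]
        exact mul_mem ha (hρN _)
      · have h1 := key (a - k • ρ x) x
        rw [sub_add_cancel, ← mul_inv_eq_iff_eq_mul] at h1
        rw [← h1]
        exact mul_mem ha (inv_mem (hρN _))
    | zero => simp
    | add b c _ _ hb hc =>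
      intro a ha
      rw [smul_add, ← add_assoc, ← sub_sub]
      exact ⟨(hc _ (hb a ha).1).1, (hc _ (hb a ha).2).2⟩
    | neg b _ hb =>
      intro a ha
      rw [smul_neg, sub_neg_eq_add, ← sub_eq_add_neg]
      exact (hb a ha).symm
  apply hN.1
  rw [eq_top_iff]
  rintro ⟨y, hy⟩ -
  obtain ⟨u, v, huv⟩ := Nat.isCoprime_iff_coprime.2 hck
  have h1 : y = k • (v • y) := by
    rw [← natCast_zsmul, smul_smul]
    conv_lhs => rw [← one_zsmul y, ← huv, add_smul, mul_smul, natCast_zsmul,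
      mem_torsionSubgroup.1 hy, smul_zero, zero_add, mul_comm]
  have h2 := (hadd (v • y) 0 (by rw [← one_eq_zero]; exact one_mem _)).1
  rw [zero_add, ← h1] at h2
  obtain ⟨z, hz, rfl⟩ := h2
  exact hz

end LeftBrace

/-! ### Cycle sets: simplicity, irretractability and the socle. -/

namespace CycleSet

variable {X : Type*} [CycleSet X]

theorem sigma_apply (x y : X) : sigma x y = dot x y := rfl

theorem squaringMap_apply (x : X) : squaringMap X x = dot x x := rfl

theorem inv_sigmaG (x : X) : (sigmaG x)⁻¹ = sumG {x} := Subtype.ext (sumPerm_singleton x).symm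

section Finite

variable [Finite X]

theorem lambdaAut_sumG (s t : Multiset X) :
    LeftBrace.lambdaAut (sumG s) (sumG t) = sumG (t.map (sumPerm s)) := by
  have h := sumG_mul s t
  rw [← sumG_add] at h
  exact add_left_cancel ((LeftBrace.mul_eq_add_lambdaAut (sumG s) (sumG t)).symm.trans h)

theorem lambdaAut_inv_sigmaG (g : permGroup X) (x : X) :
    LeftBrace.lambdaAut g (sigmaG x)⁻¹ = (sigmaG ((g : Equiv.Perm X) x))⁻¹ := by
  obtain ⟨s, rfl⟩ := sumG_surjective g
  rw [inv_sigmaG, inv_sigmaG, lambdaAut_sumG, Multiset.map_singleton]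
  rfl

theorem closure_range_inv_sigmaG :
    AddSubgroup.closure (Set.range fun x : X => (sigmaG x)⁻¹) = ⊤ := by
  rw [eq_top_iff]
  rintro g -
  obtain ⟨s, rfl⟩ := sumG_surjective g
  induction s using Multiset.induction_on with
  | empty => exact zero_mem _
  | cons x s ih =>
    rw [← Multiset.singleton_add, ← sumG_add]
    exact add_mem (AddSubgroup.subset_closure ⟨x, inv_sigmaG x⟩) ih

/-- **Rump's decomposition theorem**: a finite indecomposable square-free cycle set has at most one
element. -/
theorem IsIndecomposable.subsingleton (hX : IsIndecomposable X) (hT : ∀ x : X, dot x x = x) :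
    Subsingleton X := by
  have : MulAction.IsPretransitive (permGroup X) X := hX
  refine LeftBrace.subsingleton_of_smul_eq_self (B := permGroup X) (fun x : X => (sigmaG x)⁻¹)
    (fun g x => (lambdaAut_inv_sigmaG g x).symm) closure_range_inv_sigmaG fun x => ?_
  change (sigma x)⁻¹ x = x
  rw [Equiv.Perm.inv_eq_iff_eq]
  exact (hT x).symm

end Finite

open scoped Pointwise in
/-- A set which is stable under all left multiplications of a finite indecomposable cycle set is
empty or everything. -/
theorem IsIndecomposable.mem_of_stable [Finite X] (hX : IsIndecomposable X) {S : Set X}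
    (hS : ∀ x, ∀ y ∈ S, dot x y ∈ S) {y : X} (hy : y ∈ S) (z : X) : z ∈ S := by
  have : MulAction.IsPretransitive (permGroup X) X := hX
  obtain ⟨⟨g, hg⟩, rfl⟩ := MulAction.exists_smul_eq (permGroup X) y z
  change g y ∈ S
  have himage : ∀ x, sigma x '' S = S := fun x =>
    Set.eq_of_subset_of_ncard_le (Set.image_subset_iff.2 (hS x))
      (Set.ncard_image_of_injective S (sigma x).injective).ge (Set.toFinite _)
  have hle : permGroup X ≤ MulAction.stabilizer (Equiv.Perm X) S := by
    refine (Subgroup.closure_le _).2 ?_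
    rintro _ ⟨x, rfl⟩
    exact himage x
  have h1 : g • S = S := hle hg
  rw [← h1]
  exact ⟨y, hy, rfl⟩

theorem IsHom.isIndecomposable {Y : Type*} [CycleSet Y] [Finite X] {f : X → Y} (hf : IsHom f)
    (hs : Function.Surjective f) (hX : IsIndecomposable X) : IsIndecomposable Y := by
  refine ⟨fun a b => ?_⟩
  obtain ⟨x, rfl⟩ := hs a
  obtain ⟨x', rfl⟩ := hs b
  -- The points whose images lie in the orbit of `f x` form a stable set.
  refine hX.mem_of_stable (S := {z | ∃ g : permGroup Y, g • f x = f z}) ?_ ⟨1, one_smul _ _⟩ x'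
  rintro u z ⟨g, hg⟩
  refine ⟨sigmaG (f u) * g, ?_⟩
  rw [mul_smul, hg, hf]
  rfl

/-- A homomorphism from a finite indecomposable cycle set is injective if one of its fibres has
only one element. -/
theorem IsHom.injective_of_fibre {Y : Type*} [CycleSet Y] [Finite X] {f : X → Y} (hf : IsHom f)
    (hX : IsIndecomposable X) {x : X} (hx : ∀ y, f y = f x → y = x) : Function.Injective f := by
  -- The points alone in their fibres form a stable set, because left multiplications are bijective
  -- in `X` and injective in `Y`.
  have h : ∀ z : X, z ∈ {z : X | ∀ y, f y = f z → y = z} := by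
    refine hX.mem_of_stable ?_ hx
    intro u z hz y hy
    obtain ⟨w, rfl⟩ := (bijective_dot u).2 y
    rw [hf, hf] at hy
    rw [hz w ((bijective_dot (f u)).1 hy)]
  exact fun a b hab => h b a hab

theorem isSimple_of_isCycle [Finite X] {p : ℕ} (hp : p.Prime) (hX : IsIndecomposable X)
    (hT : (squaringMap X).IsCycle) (hTp : {x : X | squaringMap X x ≠ x}.ncard = p) :
    IsSimple X := by
  classical
  have := Fintype.ofFinite X
  intro Y _ f hf hs
  by_cases hY : ∀ y : Y, dot y y = y
  · right
    have := Finite.of_surjective f hs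
    have := (hf.isIndecomposable hs hX).subsingleton hY
    obtain ⟨x, -⟩ := hT
    have : Nonempty Y := ⟨f x⟩
    exact Nat.card_eq_one_iff_unique.2 ⟨inferInstance, inferInstance⟩
  left
  push Not at hY
  obtain ⟨y, hy⟩ := hY
  obtain ⟨x, rfl⟩ := hs y
  refine ⟨f, hf, hf.injective_of_fibre hX (x := x) ?_, hs⟩
  have hiter : ∀ (n : ℕ) (z : X), f ((squaringMap X ^ n) z) = (squaringMap Y ^ n) (f z) := by
    intro n z
    induction n with
    | zero => rfl
    | succ n ih => rw [pow_succ', pow_succ', Equiv.Perm.mul_apply, Equiv.Perm.mul_apply, ← ih,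
        squaringMap_apply, squaringMap_apply, hf]
  have hmoved : ∀ z, f z = f x → squaringMap X z ≠ z := by
    intro z hz h
    apply hy
    rw [← hz, ← hf]
    exact congrArg f h
  have hord : orderOf (squaringMap X) = p := by
    rw [hT.orderOf, ← hTp, ← Set.ncard_coe_finset]
    congr 1
    ext z
    simp
  intro z hz
  obtain ⟨i, hi⟩ := hT.exists_pow_eq (hmoved x rfl) (hmoved z hz)
  by_contra hzx
  have hpi : ¬ p ∣ i := by
    intro h
    rw [← hord, orderOf_dvd_iff_pow_eq_one] at h
    rw [h] at hi
    exact hzx hi.symm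
  have h1 : (squaringMap Y ^ i) (f x) = f x := by rw [← hiter, hi, hz]
  have h2 : (squaringMap Y ^ p) (f x) = f x := by rw [← hiter, ← hord, pow_orderOf_eq_one]; rfl
  -- By Bézout the stabilizer of `f x` contains the power with exponent `gcd i p = 1`, the squaring
  -- map itself.
  have h3 : squaringMap Y ^ Nat.gcd i p ∈ MulAction.stabilizer (Equiv.Perm Y) (f x) := by
    have e1 : squaringMap Y ^ i ∈ MulAction.stabilizer (Equiv.Perm Y) (f x) := h1
    have e2 : squaringMap Y ^ p ∈ MulAction.stabilizer (Equiv.Perm Y) (f x) := h2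
    rw [← zpow_natCast, Nat.gcd_eq_gcd_ab, zpow_add, zpow_mul, zpow_mul, zpow_natCast, zpow_natCast]
    exact mul_mem (zpow_mem e1 _) (zpow_mem e2 _)
  rw [Nat.gcd_comm, (Nat.Prime.coprime_iff_not_dvd hp).2 hpi, pow_one] at h3
  exact hy h3

/-- The retract relation is a congruence. -/
theorem sigma_dot_congr {x x' y y' : X} (hx : sigma x = sigma x') (hy : sigma y = sigma y') :
    sigma (dot x y) = sigma (dot x' y') := by
  have h1 : dot x' y' = dot x y' := by rw [← sigma_apply, ← sigma_apply, hx]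
  have h2 := sigma_mul_sigma x y
  have h3 := sigma_mul_sigma x y'
  have h4 : dot y x = dot y' x := by rw [← sigma_apply, ← sigma_apply, hy]
  rw [h1]
  rw [hy, h4, ← h3] at h2
  exact mul_right_cancel h2

/-- The retraction of a finite cycle set is a cycle set. -/
noncomputable instance [Finite X] : CycleSet (Ret X) where
  dot := Quotient.map₂ dot fun _ _ hx _ _ hy => sigma_dot_congr hx hy
  bijective_dot := by
    have : Finite (Ret X) := Quotient.finite _
    rintro ⟨x⟩
    refine Finite.surjective_iff_bijective.1 ?_
    rintro ⟨y⟩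
    obtain ⟨z, rfl⟩ := (bijective_dot x).2 y
    exact ⟨Quotient.mk _ z, rfl⟩
  cycloid := by
    rintro ⟨x⟩ ⟨y⟩ ⟨z⟩
    exact congrArg (Quotient.mk _) (cycloid x y z)
  bijective_sq := by
    have : Finite (Ret X) := Quotient.finite _
    refine Finite.surjective_iff_bijective.1 ?_
    rintro ⟨y⟩
    obtain ⟨z, rfl⟩ := bijective_sq.2 y
    exact ⟨Quotient.mk _ z, rfl⟩

theorem IsSimple.isIrretractable [Finite X] (hS : IsSimple X) (hX : IsIndecomposable X)
    (hT : (squaringMap X).IsCycle)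
    (hp : ¬ {x : X | squaringMap X x ≠ x}.ncard = Nat.card X) : IsIrretractable X := by
  have : Finite (Ret X) := Quotient.finite _
  have hsurj : Function.Surjective (Quotient.mk (retractSetoid X) : X → Ret X) :=
    Quotient.mk_surjective
  rcases hS (Ret X) (Quotient.mk (retractSetoid X)) (fun _ _ => rfl) hsurj with ⟨g, -, hg⟩ | h
  · exact (Nat.bijective_iff_surjective_and_card _).2 ⟨hsurj, Nat.card_eq_of_bijective g hg⟩
  · exfalso
    have hsub := (Nat.card_eq_one_iff_unique.1 h).1
    -- If the retraction is a point, every `σ_x` is the squaring map. The points it moves are then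
    -- stable and exhaust `X`, contrary to `hp`.
    have hσ : ∀ x y : X, dot x y = dot y y := fun x y =>
      congrFun (congrArg DFunLike.coe
        (Quotient.exact (hsub.elim (Quotient.mk (retractSetoid X) x) (Quotient.mk _ y)))) y
    apply hp
    rw [← Set.ncard_univ]
    congr 1
    rw [Set.eq_univ_iff_forall]
    obtain ⟨x, hx, -⟩ := hT
    refine hX.mem_of_stable ?_ hx
    intro u z hz
    rw [hσ]
    exact fun h1 => hz ((squaringMap X).injective h1)

/-- If `λ_g` is trivial, then `σ` agrees at `g x` and at `x`, and irretractability gives `g x = x`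
for all `x`. -/
theorem IsIrretractable.socle_eq [Finite X] (hX : IsIrretractable X) :
    (LeftBrace.socle (permGroup X) : Set (permGroup X)) = {0} := by
  have h0 : (0 : permGroup X) = 1 := LeftBrace.one_eq_zero.symm
  ext g
  rw [Set.mem_singleton_iff]
  constructor
  · intro hg
    have h1 : ∀ a : permGroup X, LeftBrace.lambdaAut g a = a := fun a =>
      congrArg (fun φ : Multiplicative (AddAut (permGroup X)) => φ.toAdd a) (MonoidHom.mem_ker.1 hg)
    rw [h0]
    ext x
    have h2 := h1 (sigmaG x)⁻¹
    rw [lambdaAut_inv_sigmaG, inv_inj] at h2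
    exact hX.1 (Quotient.sound (congrArg Subtype.val h2))
  · rintro rfl
    rw [← LeftBrace.one_eq_zero]
    exact one_mem _

end CycleSet

theorem mainTheorem6 {X : Type*} [CycleSet X] [Finite X] (p : ℕ) (hp : p.Prime)
    (hX : CycleSet.IsIndecomposable X)
    (hT : (CycleSet.squaringMap X).IsCycle)
    (hTp : {x : X | CycleSet.squaringMap X x ≠ x}.ncard = p) :
    CycleSet.IsSimple X ∧
      (¬ (Nat.card X).Prime →
        CycleSet.IsIrretractable X ∧
          (LeftBrace.socle (CycleSet.permGroup X) : Set (CycleSet.permGroup X)) = {0}) := by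
  have hS := CycleSet.isSimple_of_isCycle hp hX hT hTp
  refine ⟨hS, fun hcard => ?_⟩
  have hI := hS.isIrretractable hX hT fun h => hcard (h ▸ hTp ▸ hp)
  exact ⟨hI, hI.socle_eq⟩
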